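/- Fix a dimension $D\ge 1$ and constants $a>0$, $b\ge D$, $\kappa,\rho,L>0$. Let $\mathcal P_{a,b}=\mathcal P_{a,b,\kappa,\rho,L}$ be the set of Borel probability measures $\mathbb P$ on $\mathbb R^D$ such that - $\mathbb P$ is $(a,b)$-standard: $\mathbb P(B(x,t))\ge \min(1,a t^b)$ for all $x$ in the support $\mathcal X_{\mathbb P}$ and all $t>0$; - $\mathcal X_{\mathbb P}$ is a smooth compact submanifold of $\mathbb R^D$, possibly with boundary, with reach larger than $\kappa$, convexity radius larger than $\rho$, and diameter satisfying $0<\operatorname{diam}(\mathcal X_{\mathbb P})<L$. A modulus of continuity is a continuous, non-negative, non-decreasing, subadditive function $\omega$ on $[0,\infty)$ with $\omega(0)=0$. Let $\mathcal F(\mathbb P,\omega)$ be the set of Morse-type functions $f:\mathcal X_{\mathbb P}\to\mathbb R$ such that $\sup_{\|x-x'\|\le\delta}|f(x)-f(x')|\le\omega(\delta)$ for all $\delta>0$. Here $f$ is of Morse type if it is continuous, there is a finite set of critical values such that over each complementary open interval $f$ is a trivial product with compact locally connected fibre, whose trivialization extends continuously to the closed interval, and every level set has finitely generated homology. The Reeb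 graph $\mathrm R_f(\mathcal X_{\mathbb P})$ is the quotient of $\mathcal X_{\mathbb P}$ that identifies the points lying in a same connected component of a level set of $f$, with the function induced by $f$. For two spaces with real functions, $d_\Delta$ denotes the bottleneck distance between their extended persistence diagrams (with coefficients in a field), where points may be matched only if they have the same type (ordinary, relative, extended) and the same homological dimension. There is a constant $C>0$, depending only on $a$, $b$ and the geometric parameters $D,\kappa,\rho,L$, such that for every coefficient field, every modulus of continuity $\omega$, every $n\ge 1$, and every estimator $\hat{\mathrm R}_n$ of the Reeb graph from $n$ independent observations with law $\mathbb P$ (an estimator may use the sample and the filter $f$, even as the restriction of a known function on $\mathbb R^D$, and takes values in spaces with real functions, in particular in graphs with functions), $$\sup_{\mathbb P\in\mathcal P_{a,b}}\ \mathbb E\Big[\sup_{f\in\mathcal F(\mathbb P,\omega)} d_\Delta\big(\mathrm R_f(\mathcal X_{\mathbb P}),\hat{\mathrm R}_n\big)\Big]\ \ge\ C\,\omega\!\left(\Big(\frac1{an}\Big)^{1/b}\right).$$ (If the integrand is not measurable, the expectation is read as a lower integral.) -/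

import Mathlib

open scoped ENNReal
open MeasureTheory Set

noncomputable section

namespace ReebMinimax

/-! ## Singular chains and relative singular homology -/

section Homology

variable (𝕜 : Type*) [Field 𝕜] (T : Type*) [TopologicalSpace T]

/-- The singular `p`-simplices of `T`. -/
abbrev SingularSimplex (p : ℕ) : Type _ := C(stdSimplex ℝ (Fin (p + 1)), T)

/-- The module of singular `p`-chains of `T`. -/
abbrev Chain (p : ℕ) : Type _ := SingularSimplex T p →₀ 𝕜

variable {T}

/-- The `i`-th face of a singular simplex. -/
def SingularSimplex.face {p : ℕ} (σ : SingularSimplex T (p + 1)) (i : Fin (p + 2)) :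
    SingularSimplex T p :=
  σ.comp ⟨stdSimplex.map (Fin.succAbove i), stdSimplex.continuous_map _⟩

/-- The boundary operator `∂ σ = ∑ i, (-1) ^ i • (i-th face of σ)`. -/
def boundary (p : ℕ) : Chain 𝕜 T (p + 1) →ₗ[𝕜] Chain 𝕜 T p :=
  Finsupp.lift (Chain 𝕜 T p) 𝕜 (SingularSimplex T (p + 1)) fun σ =>
    ∑ i : Fin (p + 2), Finsupp.single (σ.face i) ((-1 : 𝕜) ^ (i : ℕ))

/-- The chains of `T` all of whose simplices lie in the subset `A`: the singular chains of the
subspace `A`. -/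
def chainsIn (p : ℕ) (A : Set T) : Submodule 𝕜 (Chain 𝕜 T p) :=
  Finsupp.supported 𝕜 𝕜 {σ : SingularSimplex T p | range σ ⊆ A}

/-- The relative cycles of the pair `B ⊆ A`: chains of `A` whose boundary is a chain of `B`. -/
def relCycles : (p : ℕ) → (A B : Set T) → Submodule 𝕜 (Chain 𝕜 T p)
  | 0, A, _ => chainsIn 𝕜 0 A
  | p + 1, A, B => chainsIn 𝕜 (p + 1) A ⊓ (chainsIn 𝕜 p B).comap (boundary 𝕜 p)

/-- The relative boundaries of the pair `B ⊆ A`. The singular homology `H_p(A, B; 𝕜)` is the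
quotient of `relCycles 𝕜 p A B` by `relBoundaries 𝕜 p A B`, and the map that an inclusion of pairs
`(A, B) ⊆ (A', B')` induces on homology sends the class of a relative cycle to its own class. -/
def relBoundaries (p : ℕ) (A B : Set T) : Submodule 𝕜 (Chain 𝕜 T p) :=
  (chainsIn 𝕜 (p + 1) A).map (boundary 𝕜 p) ⊔ chainsIn 𝕜 p B

end Homology

/-! ## Extended persistence diagrams -/

/-- The index set `ℝ ∪ {+∞} ∪ ℝᵒᵖ` of the extended filtration. -/
inductive ExtIndex : Type
  | ord (α : ℝ)
  | infty
  | rel (α : ℝ)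

/-- The strict order of the index set: every `ord α` is before `infty`, which is before every
`rel β`; the `ord` part is ordered as `ℝ`, the `rel` part in the opposite way. -/
def ExtIndex.Before : ExtIndex → ExtIndex → Prop
  | .ord α, .ord β => α < β
  | .ord _, _ => True
  | .infty, .rel _ => True
  | .rel α, .rel β => β < α
  | _, _ => False

section Persistence

variable (𝕜 : Type*) [Field 𝕜] {T : Type*} [TopologicalSpace T] (h : T → ℝ)

/-- First space of the pair at an index of the extended filtration of `h`: the sublevel set
`{h ≤ α}` in the ordinary part, then the whole space. -/
def extUpper : ExtIndex → Set T
  | .ord α => {x | h x ≤ α}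
  | .infty => univ
  | .rel _ => univ

/-- Second space of the pair at an index of the extended filtration of `h`: empty up to `+∞`, then
the superlevel set `{h ≥ α}`. -/
def extLower : ExtIndex → Set T
  | .ord _ => ∅
  | .infty => ∅
  | .rel α => {x | α ≤ h x}

/-- Cycles representing the `p`-th extended persistence module `V_i = H_p(F_i; 𝕜)` at index `i`. -/
def extCycles (p : ℕ) (i : ExtIndex) : Submodule 𝕜 (Chain 𝕜 T p) :=
  relCycles 𝕜 p (extUpper h i) (extLower h i)

/-- Boundaries for the `p`-th extended persistence module at index `i`. -/
def extBoundaries (p : ℕ) (i : ExtIndex) : Submodule 𝕜 (Chain 𝕜 T p) :=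
  relBoundaries 𝕜 p (extUpper h i) (extLower h i)

/-- The multiplicity of the interval `[b, d)` in the `p`-th extended persistence module `V` of `h`.
It is the dimension of
`ker (V_b → V_d) / (⋃_{b ≤ t < d} ker (V_b → V_t) + ker (V_b → V_d) ∩ ∑_{s < b} im (V_s → V_b))`,
written with representing chains. If `V` is a direct sum of interval modules on half-open
intervals, then this is the number of summands on `[b, d)`. -/
def intervalMultiplicity (p : ℕ) (b d : ExtIndex) : ℕ∞ :=
  -- classes at `b` that vanish at `d`
  let dying : Submodule 𝕜 (Chain 𝕜 T p) := extCycles 𝕜 h p b ⊓ extBoundaries 𝕜 h p d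
  -- classes at `b` that vanish before `d`
  let early : Submodule 𝕜 (Chain 𝕜 T p) :=
    ⨆ t : ExtIndex, ⨆ _ : (t = b ∨ b.Before t) ∧ t.Before d,
      extCycles 𝕜 h p b ⊓ extBoundaries 𝕜 h p t
  -- classes at `b` that come from before `b`
  let old : Submodule 𝕜 (Chain 𝕜 T p) :=
    extBoundaries 𝕜 h p b ⊔ ⨆ s : ExtIndex, ⨆ _ : s.Before b, extCycles 𝕜 h p s
  Cardinal.toENat (Module.rank 𝕜 (dying.map (early ⊔ (dying ⊓ old)).mkQ))

end Persistence

/-- The types of the points of an extended persistence diagram. -/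
inductive PointType : Type
  | ordinary
  | relative
  | extended

/-- A persistence diagram: a multiset of points of the plane, each with a type and a homological
dimension, given by its multiplicity function. -/
abbrev Diagram : Type := PointType → ℕ → ℝ × ℝ → ℕ∞

/-- The extended persistence diagram of a real function `h` on a space. -/
def extendedDiagram (𝕜 : Type*) [Field 𝕜] {T : Type*} [TopologicalSpace T] (h : T → ℝ) : Diagram
  | .ordinary, p, q => intervalMultiplicity 𝕜 h p (.ord q.1) (.ord q.2)
  | .relative, p, q => intervalMultiplicity 𝕜 h p (.rel q.1) (.rel q.2)
  | .extended, p, q => intervalMultiplicity 𝕜 h p (.ord q.1) (.rel q.2)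

/-! ## The bottleneck distance -/

/-- A point of a diagram; `copy` numbers the copies of a point of higher multiplicity. -/
@[ext] structure Diagram.Point (S : Diagram) where
  type : PointType
  dim : ℕ
  pos : ℝ × ℝ
  copy : ℕ
  copy_lt : (copy : ℕ∞) < S type dim pos

/-- The diagonal of the plane. -/
def diagonal : Set (ℝ × ℝ) := {q | q.1 = q.2}

/-- `Γ` is a partial matching between the points of two diagrams. -/
structure IsPartialMatching {S S' : Diagram} (Γ : Set (S.Point × S'.Point)) : Prop where
  right_unique : ∀ p p' q', (p, p') ∈ Γ → (p, q') ∈ Γ → p' = q'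
  left_unique : ∀ p q p', (p, p') ∈ Γ → (q, p') ∈ Γ → p = q
  type_eq : ∀ p p', (p, p') ∈ Γ → p.type = p'.type
  dim_eq : ∀ p p', (p, p') ∈ Γ → p.dim = p'.dim

/-- The cost of a partial matching: the largest sup-norm distance between matched points or
between an unmatched point and the diagonal (`ℝ × ℝ` carries the sup norm). -/
def matchingCost {S S' : Diagram} (Γ : Set (S.Point × S'.Point)) : ℝ≥0∞ :=
  (⨆ p : S.Point, ⨆ p' : S'.Point, ⨆ _ : (p, p') ∈ Γ, edist p.pos p'.pos) ⊔
    (⨆ p : S.Point, ⨆ _ : ∀ p', (p, p') ∉ Γ, Metric.infEDist p.pos diagonal) ⊔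
    (⨆ p' : S'.Point, ⨆ _ : ∀ p, (p, p') ∉ Γ, Metric.infEDist p'.pos diagonal)

/-- The bottleneck distance between two diagrams. -/
def bottleneck (S S' : Diagram) : ℝ≥0∞ :=
  ⨅ Γ : Set (S.Point × S'.Point), ⨅ _ : IsPartialMatching Γ, matchingCost Γ

/-- A topological space with a real function. This includes every Reeb graph with its induced
function, and (the geometric realization of) every combinatorial graph with the piecewise linear
interpolation of a function on its nodes. -/
structure FilteredSpace where
  carrier : Type
  [top : TopologicalSpace carrier]
  height : carrier → ℝ

attribute [instance] FilteredSpace.top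

/-- The persistence metric `d_Δ`: the bottleneck distance between the extended persistence
diagrams. -/
def persistenceDist (𝕜 : Type*) [Field 𝕜] (G G' : FilteredSpace) : ℝ≥0∞ :=
  bottleneck (extendedDiagram 𝕜 G.height) (extendedDiagram 𝕜 G'.height)

/-! ## Reeb graphs and functions of Morse type -/

section Reeb

variable {X : Type} [TopologicalSpace X] (f : X → ℝ)

/-- Two points are identified if they lie in the same connected component of a level set. -/
def reebSetoid : Setoid X where
  r x y := y ∈ connectedComponentIn (f ⁻¹' {f x}) x
  iseqv :=
    { refl := fun x => mem_connectedComponentIn (by simp)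
      symm := by
        intro x y hxy
        have hf : f y = f x := connectedComponentIn_subset (f ⁻¹' {f x}) x hxy
        rw [hf, ← connectedComponentIn_eq hxy]
        exact mem_connectedComponentIn (by simp)
      trans := by
        intro x y z hxy hyz
        have hf : f y = f x := connectedComponentIn_subset (f ⁻¹' {f x}) x hxy
        rw [hf, ← connectedComponentIn_eq hxy] at hyz
        exact hyz }

/-- The Reeb graph of `f`: the quotient space, with the function induced by `f`. -/
def reebGraph : FilteredSpace where
  carrier := Quotient (reebSetoid f)
  height := Quotient.lift f fun x y (hxy : y ∈ connectedComponentIn (f ⁻¹' {f x}) x) => by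
    have hf : f y = f x := connectedComponentIn_subset (f ⁻¹' {f x}) x hxy
    exact hf.symm

/-- `f` is of Morse type on the compact space `X`. Two consecutive elements `u < v` of
`{-∞} ∪ crit ∪ {+∞}` are extended reals without a critical value strictly between them. -/
structure IsMorseType.{u} (𝕜 : Type u) [Field 𝕜] : Prop where
  compact : CompactSpace X
  continuous : Continuous f
  critical : ∃ crit : Finset ℝ, ∀ u v : EReal,
    (u = ⊥ ∨ ∃ c ∈ crit, u = (c : ℝ)) → (v = ⊤ ∨ ∃ c ∈ crit, v = (c : ℝ)) → u < v →
    (∀ c ∈ crit, ¬ (u < (c : ℝ) ∧ ((c : ℝ) : EReal) < v)) →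
    ∃ (Y : Type) (_ : TopologicalSpace Y) (_ : CompactSpace Y) (_ : LocallyConnectedSpace Y)
      (μ : Y × {t : ℝ // u < t ∧ t < v} ≃ₜ {x : X // u < f x ∧ f x < v})
      (μbar : C(Y × {t : ℝ // u ≤ t ∧ t ≤ v}, {x : X // u ≤ f x ∧ f x ≤ v})),
      (∀ z, f (μ z) = z.2) ∧
      ∀ (y : Y) (t : ℝ) (ht : u < t ∧ t < v),
        (μbar (y, ⟨t, ht.1.le, ht.2.le⟩) : X) = μ (y, ⟨t, ht⟩)
  homology : ∀ t : ℝ,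
    (∀ p : ℕ, Module.Finite 𝕜
      (((AlgebraicTopology.singularHomologyFunctor (ModuleCat.{u} 𝕜) p).obj
        (ModuleCat.of 𝕜 𝕜)).obj (TopCat.of {x : X // f x = t}))) ∧
    ∃ N : ℕ, ∀ p ≥ N, Subsingleton
      (((AlgebraicTopology.singularHomologyFunctor (ModuleCat.{u} 𝕜) p).obj
        (ModuleCat.of 𝕜 𝕜)).obj (TopCat.of {x : X // f x = t}))

end Reeb

/-! ## Geometry of subsets of Euclidean space -/

section Geometry

variable {D : ℕ}

/-- `X` is a smooth embedded submanifold of `ℝ^D`, possibly with boundary: near each of its points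
there is a smooth chart of `ℝ^D` that maps `X` to `ℝ^k × {0}` or to the half-space
`[0, ∞) × ℝ^(k-1) × {0}`. -/
def IsSmoothSubmanifold (X : Set (EuclideanSpace ℝ (Fin D))) : Prop :=
  ∃ k ≤ D, ∀ x ∈ X, ∃ φ : OpenPartialHomeomorph (EuclideanSpace ℝ (Fin D))
      (EuclideanSpace ℝ (Fin D)),
    x ∈ φ.source ∧ ContDiffOn ℝ (⊤ : ℕ∞) φ φ.source ∧ ContDiffOn ℝ (⊤ : ℕ∞) φ.symm φ.target ∧
    ((∀ y ∈ φ.source, y ∈ X ↔ ∀ i : Fin D, k ≤ i.val → φ y i = 0) ∨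
      (∀ y ∈ φ.source, y ∈ X ↔
        (∀ i : Fin D, k ≤ i.val → φ y i = 0) ∧ ∀ i : Fin D, i.val = 0 → 0 ≤ φ y i))

/-- The reach of `X`: the supremum of the `r` such that every point at distance less than `r` from
`X` has a unique nearest point in `X`. -/
def reach (X : Set (EuclideanSpace ℝ (Fin D))) : ℝ≥0∞ :=
  sSup {r | ∀ y, Metric.infEDist y X < r → ∃! x, x ∈ X ∧ edist y x = Metric.infEDist y X}

/-- The geodesic distance of `X`: the infimum of the lengths of the paths in `X`. -/
def geodesicEDist (X : Set (EuclideanSpace ℝ (Fin D))) (x y : X) : ℝ≥0∞ :=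
  ⨅ γ : Path x y, eVariationOn (fun t => (γ t : EuclideanSpace ℝ (Fin D))) univ

/-- `γ` is a minimizing geodesic of `X` from `x` to `y`, parametrized with constant speed. -/
def IsMinGeodesic (X : Set (EuclideanSpace ℝ (Fin D))) (x y : X) (γ : Path x y) : Prop :=
  ∀ s t, geodesicEDist X (γ s) (γ t) = edist s t * geodesicEDist X x y

/-- A subset `S` of `X` is geodesically convex if any two of its points are joined by a unique
minimizing geodesic of `X`, and this geodesic stays in `S`. -/
def IsGeodesicallyConvex (X : Set (EuclideanSpace ℝ (Fin D))) (S : Set X) : Prop :=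
  ∀ x ∈ S, ∀ y ∈ S, ∃ γ : Path x y, IsMinGeodesic X x y γ ∧ (∀ t, γ t ∈ S) ∧
    ∀ γ' : Path x y, IsMinGeodesic X x y γ' → γ' = γ

/-- The convexity radius of `X`: the supremum of the `r` such that all geodesic balls of radius
less than `r` are geodesically convex. -/
def convexityRadius (X : Set (EuclideanSpace ℝ (Fin D))) : ℝ≥0∞ :=
  sSup {r | ∀ x : X, ∀ s < r, IsGeodesicallyConvex X {y | geodesicEDist X x y < s}}

end Geometry

/-! ## The statistical model -/

/-- The support of a distribution. -/
abbrev supp {D : ℕ} (P : ProbabilityMeasure (EuclideanSpace ℝ (Fin D))) :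
    Set (EuclideanSpace ℝ (Fin D)) :=
  (P : Measure (EuclideanSpace ℝ (Fin D))).support

/-- The class of `(a, b)`-standard distributions on `ℝ^D` whose support is a smooth compact
submanifold with reach larger than `κ`, convexity radius larger than `ρ`, and positive diameter
less than `L`. -/
structure InModel (D : ℕ) (a b κ ρ L : ℝ)
    (P : ProbabilityMeasure (EuclideanSpace ℝ (Fin D))) : Prop where
  standard : ∀ x ∈ supp P, ∀ t : ℝ, 0 < t →
    ENNReal.ofReal (min 1 (a * t ^ b)) ≤
      (P : Measure (EuclideanSpace ℝ (Fin D))) (Metric.closedBall x t)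
  compact : IsCompact (supp P)
  submanifold : IsSmoothSubmanifold (supp P)
  reach_gt : ENNReal.ofReal κ < reach (supp P)
  convexityRadius_gt : ENNReal.ofReal ρ < convexityRadius (supp P)
  diam_pos : 0 < Metric.diam (supp P)
  diam_lt : Metric.diam (supp P) < L

/-- `ω` is a modulus of continuity; only its values on `[0, ∞)` matter. -/
structure IsModulusOfContinuity (ω : ℝ → ℝ) : Prop where
  zero : ω 0 = 0
  nonneg : ∀ δ, 0 ≤ δ → 0 ≤ ω δ
  mono : MonotoneOn ω (Ici 0)
  subadditive : ∀ δ₁ δ₂, 0 ≤ δ₁ → 0 ≤ δ₂ → ω (δ₁ + δ₂) ≤ ω δ₁ + ω δ₂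
  continuousOn : ContinuousOn ω (Ici 0)

/-- The restriction of `g : ℝ^D → ℝ` to the support of `P`. -/
def filterOn {D : ℕ} (P : ProbabilityMeasure (EuclideanSpace ℝ (Fin D)))
    (g : EuclideanSpace ℝ (Fin D) → ℝ) : supp P → ℝ :=
  fun x => g x

/-- `f = g|_{supp P}` belongs to the class of filters: it is of Morse type on the support of `P`,
and its exact modulus of continuity `ω_f` satisfies `ω_f ≤ ω`. (Every function on the support is
such a restriction.) -/
structure InFilterClass (𝕜 : Type*) [Field 𝕜] {D : ℕ}
    (P : ProbabilityMeasure (EuclideanSpace ℝ (Fin D))) (ω : ℝ → ℝ)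
    (g : EuclideanSpace ℝ (Fin D) → ℝ) : Prop where
  morse : IsMorseType (filterOn P g) 𝕜
  modulus_le : ∀ δ : ℝ, 0 < δ → ∀ x x' : supp P, dist x x' ≤ δ →
    |filterOn P g x - filterOn P g x'| ≤ ω δ

/-- An estimator of the Reeb graph from `n` observations: it may use the sample and the filter,
through its values at the sample points or even as a function on `ℝ^D`. -/
abbrev Estimator (D n : ℕ) : Type 1 :=
  (Fin n → EuclideanSpace ℝ (Fin D)) → (EuclideanSpace ℝ (Fin D) → ℝ) → FilteredSpace

/-- The risk at `P` of an estimator `R`, for the loss `sup_f d_Δ(R_f(supp P), R)`. The expectation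
over `n` independent observations is a lower integral, so no measurability is needed. -/
def risk (𝕜 : Type*) [Field 𝕜] {D n : ℕ} (ω : ℝ → ℝ) (R : Estimator D n)
    (P : ProbabilityMeasure (EuclideanSpace ℝ (Fin D))) : ℝ≥0∞ :=
  ∫⁻ x : Fin n → EuclideanSpace ℝ (Fin D),
    ⨆ g : EuclideanSpace ℝ (Fin D) → ℝ, ⨆ _ : InFilterClass 𝕜 P ω g,
      persistenceDist 𝕜 (reebGraph (filterOn P g)) (R x g)
    ∂(Measure.pi fun _ => (P : Measure (EuclideanSpace ℝ (Fin D))))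

end ReebMinimax

end

/-!
The bound follows from a comparison of two distributions. The idea is to find two members of the
model that no estimator can tell apart with high probability, while their Reeb graphs for a common
filter are at distance of order `ω ((1 / (a n)) ^ (1 / b))` in the persistence metric.

Put `q = 1 / (2 n)` and let `δ` be a small multiple of `(1 / (a n)) ^ (1 / b)`. The distribution
`spikedMeasure D δ q` has mass `1 - q` at the origin and spreads the mass `q` uniformly over the
segment `axisSegment D δ` of length `δ`, which is its support. It is `(a, b)`-standard because
`a δ ^ b ≤ q` and `1 ≤ b`. Its support is a convex curve with boundary, so reach and convexity
radius are infinite (`reach_eq_top_of_convex`, `convexityRadius_eq_top_of_convex`), and its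
diameter is `δ`. The two distributions are those for `δ` and `δ / 2`
(`inModel_of_eq_spikedMeasure`).

Under both of them all observations are `0` with probability at least `1 - n q = 1 / 2`. Since this
event is an atom of the law of the sample, the risk is at least half the loss at the sample `0`
even when the loss is not measurable (`le_risk_of_le_singleton_zero`).

The filter is linear in the first coordinate, with slope `ω δ / (2 δ)`; subadditivity of `ω` keeps
it in the class (`IsModulusOfContinuity.div_mul_le`). On a segment it is a homeomorphism onto an
interval, hence of Morse type, and its heights on the two segments fill `[0, H]` and `[0, H / 2]`,
with `H = ω δ / 2`. The Reeb graph of the longer segment has an extended point `(0, H)` in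
dimension `0` (`intervalMultiplicity_ord_rel_ne_zero`); no extended point of the other one has
second coordinate above `H / 2` (`intervalMultiplicity_ord_rel_eq_zero`). Hence the two losses at
the sample `0` sum to at least `H / 2` (`le_persistenceDist_add_persistenceDist`), and one of the
two risks is at least `H / 8`.
-/

namespace ReebMinimax

/-! ### Multiplicities in the extended persistence diagram -/

section Multiplicity

variable (𝕜 : Type*) [Field 𝕜] {T : Type*} [TopologicalSpace T]

/-- The augmentation of the singular chain complex: the sum of the coefficients of a `0`-chain. -/
noncomputable def augmentation : Chain 𝕜 T 0 →ₗ[𝕜] 𝕜 :=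
  Finsupp.linearCombination 𝕜 fun _ => 1

theorem augmentation_single (σ : SingularSimplex T 0) (c : 𝕜) :
    augmentation 𝕜 (Finsupp.single σ c) = c := by
  simp [augmentation]

theorem boundary_single (σ : SingularSimplex T 1) :
    boundary 𝕜 0 (Finsupp.single σ 1) =
      Finsupp.single (σ.face 0) 1 - Finsupp.single (σ.face 1) 1 := by
  simp [boundary, Fin.sum_univ_two, sub_eq_add_neg, ← Finsupp.single_neg]

theorem augmentation_boundary (c : Chain 𝕜 T 1) : augmentation 𝕜 (boundary 𝕜 0 c) = 0 := by
  have : (augmentation 𝕜 ∘ₗ boundary 𝕜 0 : Chain 𝕜 T 1 →ₗ[𝕜] 𝕜) = 0 := by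
    refine Finsupp.lhom_ext' fun σ => LinearMap.ext_ring ?_
    simp only [LinearMap.comp_apply, Finsupp.lsingle_apply]
    rw [boundary_single, map_sub, augmentation_single, augmentation_single]
    simp
  exact LinearMap.congr_fun this c

theorem chainsIn_empty (p : ℕ) : chainsIn 𝕜 p (∅ : Set T) = ⊥ := by
  have : {σ : SingularSimplex T p | range σ ⊆ ∅} = ∅ := by
    ext σ
    simp [range_eq_empty_iff]
  rw [chainsIn, this, Finsupp.supported_empty]

theorem relBoundaries_empty_le_ker_augmentation (A : Set T) :
    relBoundaries 𝕜 0 A ∅ ≤ LinearMap.ker (augmentation 𝕜) := by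
  rw [relBoundaries, chainsIn_empty, sup_bot_eq]
  rintro _ ⟨c, -, rfl⟩
  exact augmentation_boundary 𝕜 c

theorem toENat_rank_map_mkQ_eq_zero_iff {V : Type*} [AddCommGroup V] [Module 𝕜 V]
    (A B : Submodule 𝕜 V) :
    Cardinal.toENat (Module.rank 𝕜 (A.map B.mkQ)) = 0 ↔ A ≤ B := by
  rw [Cardinal.toENat_eq_zero, Submodule.rank_eq_zero, ← LinearMap.le_ker_iff_map,
    Submodule.ker_mkQ]

variable {h : T → ℝ}

/-- An extended class cannot die at a superlevel set that is still empty: there the relative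
homology is that of the whole space. -/
theorem intervalMultiplicity_ord_rel_eq_zero (p : ℕ) (α : ℝ) {β : ℝ} (hβ : ∀ x, h x < β) :
    intervalMultiplicity 𝕜 h p (.ord α) (.rel β) = 0 := by
  rw [intervalMultiplicity, toENat_rank_map_mkQ_eq_zero_iff]
  refine le_trans ?_ le_sup_left
  refine le_trans ?_ (le_iSup₂_of_le .infty ⟨.inr trivial, trivial⟩ le_rfl)
  have : {x | β ≤ h x} = ∅ := eq_empty_of_forall_notMem fun x hx => (hβ x).not_ge hx
  simp only [extBoundaries, extLower, extUpper, this, le_refl]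

theorem map_vertex_finOne_apply {X : Type*} [Fintype X] [DecidableEq X] (f : Fin 1 → X)
    (w : stdSimplex ℝ (Fin 1)) : stdSimplex.map f w = stdSimplex.vertex (f 0) := by
  rw [Subsingleton.elim w (stdSimplex.vertex 0), stdSimplex.map_vertex]

/-- A path from a global minimum `x` to a global maximum `y` gives an extended class in dimension
`0` that is born at `h x` and dies at `h y`. It is represented by the point `x`: the point is
homologous to `y`, but before the index `rel (h y)` all boundaries have augmentation zero. -/
theorem intervalMultiplicity_ord_rel_ne_zero {x y : T} (γ : Path x y)
    (hmin : ∀ z, h x ≤ h z) (hmax : ∀ z, h z ≤ h y) :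
    intervalMultiplicity 𝕜 h 0 (.ord (h x)) (.rel (h y)) ≠ 0 := by
  rw [intervalMultiplicity, Ne, toENat_rank_map_mkQ_eq_zero_iff]
  intro hle
  let σ : SingularSimplex T 1 :=
    ⟨fun w => γ ⟨w 1, stdSimplex.zero_le w 1, stdSimplex.le_one w 1⟩, by
      refine γ.continuous.comp (Continuous.subtype_mk ?_ _)
      exact (continuous_apply (1 : Fin 2)).comp continuous_subtype_val⟩
  have h0 : ∀ w, σ.face 0 w = y := by
    intro w
    change σ (stdSimplex.map _ w) = y
    rw [map_vertex_finOne_apply]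
    simp [σ]
  have h1 : ∀ w, σ.face 1 w = x := by
    intro w
    change σ (stdSimplex.map _ w) = x
    rw [map_vertex_finOne_apply]
    simp [σ]
  have hker : ∀ i : ExtIndex, i.Before (.rel (h y)) →
      extBoundaries 𝕜 h 0 i ≤ LinearMap.ker (augmentation 𝕜) := by
    rintro (s | _ | β) hi
    · exact relBoundaries_empty_le_ker_augmentation 𝕜 _
    · exact relBoundaries_empty_le_ker_augmentation 𝕜 _
    · have : {z | β ≤ h z} = ∅ :=
        eq_empty_of_forall_notMem fun z hz => (lt_of_le_of_lt (hmax z) hi).not_ge hz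
      simp only [extBoundaries, extLower, this]
      exact relBoundaries_empty_le_ker_augmentation 𝕜 _
  have hold : ∀ s : ExtIndex, s.Before (.ord (h x)) → extCycles 𝕜 h 0 s = ⊥ := by
    rintro (s | _ | β) hs
    · have : {z | h z ≤ s} = ∅ :=
        eq_empty_of_forall_notMem fun z hz => (lt_of_lt_of_le hs (hmin z)).not_ge hz
      simp only [extCycles, extUpper, this, relCycles, chainsIn_empty]
    · exact hs.elim
    · exact hs.elim
  have hx : (Finsupp.single (σ.face 1) 1 : Chain 𝕜 T 0) ∈
      extCycles 𝕜 h 0 (.ord (h x)) ⊓ extBoundaries 𝕜 h 0 (.rel (h y)) := by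
    refine ⟨?_, ?_⟩
    · refine Finsupp.single_mem_supported 𝕜 _ ?_
      rintro _ ⟨w, rfl⟩
      simp [extUpper, h1 w]
    · have : (Finsupp.single (σ.face 1) 1 : Chain 𝕜 T 0) =
          boundary 𝕜 0 (-Finsupp.single σ 1) + Finsupp.single (σ.face 0) 1 := by
        rw [map_neg, boundary_single]
        abel
      rw [this]
      refine Submodule.add_mem_sup (Submodule.mem_map_of_mem (neg_mem ?_)) ?_
      · exact Finsupp.single_mem_supported 𝕜 _ (subset_univ _)
      · refine Finsupp.single_mem_supported 𝕜 _ ?_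
        rintro _ ⟨w, rfl⟩
        simp [extLower, h0 w]
  have hzero : augmentation 𝕜 (Finsupp.single (σ.face 1) 1 : Chain 𝕜 T 0) = 0 := by
    have hsub := hle hx
    rw [← LinearMap.mem_ker]
    refine (sup_le ?_ ?_ : _ ≤ LinearMap.ker (augmentation 𝕜)) hsub
    · exact iSup₂_le fun t ht => inf_le_right.trans (hker t ht.2)
    · refine inf_le_right.trans (sup_le (hker _ trivial) (iSup₂_le fun s hs => ?_))
      rw [hold s hs]
      exact bot_le
  rw [augmentation_single] at hzero
  exact one_ne_zero hzero

end Multiplicity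

/-! ### A lower bound for the bottleneck distance -/

/-- In the sup norm, the distance of a point of the plane to the diagonal is at least half the
difference of its coordinates. -/
theorem ofReal_half_sub_le_infEDist_diagonal (q : ℝ × ℝ) :
    ENNReal.ofReal ((q.2 - q.1) / 2) ≤ Metric.infEDist q diagonal := by
  refine Metric.le_infEDist.2 fun z (hz : z.1 = z.2) => ?_
  rw [edist_dist]
  refine ENNReal.ofReal_le_ofReal ?_
  have h1 : |q.1 - z.1| ≤ dist q z := le_max_left _ _
  have h2 : |q.2 - z.2| ≤ dist q z := le_max_right _ _
  have h3 := neg_abs_le (q.1 - z.1)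
  have h4 := le_abs_self (q.2 - z.2)
  linarith

theorem exists_edist_le_matchingCost {S S' : Diagram} {Γ : Set (S.Point × S'.Point)} (p : S.Point) :
    (∃ p', (p, p') ∈ Γ ∧ edist p.pos p'.pos ≤ matchingCost Γ) ∨
      Metric.infEDist p.pos diagonal ≤ matchingCost Γ := by
  by_cases hp : ∃ p', (p, p') ∈ Γ
  · obtain ⟨p', hp'⟩ := hp
    refine .inl ⟨p', hp', le_trans ?_ (le_sup_left.trans le_sup_left)⟩
    exact le_iSup_of_le p (le_iSup_of_le p' (le_iSup_of_le hp' le_rfl))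
  · push Not at hp
    refine .inr (le_trans ?_ (le_sup_right.trans le_sup_left))
    exact le_iSup_of_le p (le_iSup_of_le hp le_rfl)

theorem exists_edist_le_bottleneck_add {S S' : Diagram} (p : S.Point) {ε : ℝ≥0∞}
    (hε : bottleneck S S' < ε) :
    (∃ p' : S'.Point, p.type = p'.type ∧ p.dim = p'.dim ∧ edist p.pos p'.pos < ε) ∨
      Metric.infEDist p.pos diagonal < ε := by
  simp only [bottleneck, iInf_lt_iff] at hε
  obtain ⟨Γ, hΓ, hlt⟩ := hε
  rcases exists_edist_le_matchingCost (Γ := Γ) p with ⟨p', hp', hd⟩ | hd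
  · exact .inl ⟨p', hΓ.type_eq _ _ hp', hΓ.dim_eq _ _ hp', hd.trans_lt hlt⟩
  · exact .inr (hd.trans_lt hlt)

theorem bottleneck_comm_le (S S' : Diagram) : bottleneck S S' ≤ bottleneck S' S := by
  refine le_iInf₂ fun Γ hΓ => ?_
  refine iInf₂_le_of_le (Prod.swap ⁻¹' Γ) ⟨?_, ?_, ?_, ?_⟩ ?_
  · exact fun p p' q' h h' => hΓ.left_unique _ _ _ h h'
  · exact fun p q p' h h' => hΓ.right_unique _ _ _ h h'
  · exact fun p p' h => (hΓ.type_eq _ _ h).symm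
  · exact fun p p' h => (hΓ.dim_eq _ _ h).symm
  · refine sup_le (sup_le ?_ ?_) ?_
    · refine iSup_le fun p => iSup_le fun p' => iSup_le fun h => ?_
      rw [edist_comm]
      refine le_trans ?_ (le_sup_left.trans le_sup_left)
      exact le_iSup_of_le p' (le_iSup_of_le p (le_iSup_of_le h le_rfl))
    · exact le_sup_right
    · exact le_sup_right.trans le_sup_left

/-- A substitute for the triangle inequality: if a point `p` of `S₀` is at distance at least `r`
from the diagonal and from all points of `S₁` of the same type and dimension, then no diagram is
close to both `S₀` and `S₁`. -/
theorem le_bottleneck_add_bottleneck {S₀ S₁ : Diagram} (S : Diagram) (p : S₀.Point) {r : ℝ≥0∞}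
    (hdiag : r ≤ Metric.infEDist p.pos diagonal)
    (hfar : ∀ p' : S₁.Point, p.type = p'.type → p.dim = p'.dim → r ≤ edist p.pos p'.pos) :
    r ≤ bottleneck S₀ S + bottleneck S₁ S := by
  refine ENNReal.le_of_forall_pos_le_add fun ε hε hfin => ?_
  rw [ENNReal.add_lt_top] at hfin
  have hpos : ((ε / 2 : NNReal) : ℝ≥0∞) ≠ 0 := by
    simpa using (half_pos hε).ne'
  have hsum : bottleneck S₀ S + bottleneck S₁ S + ε =
      (bottleneck S₀ S + (ε / 2 : NNReal)) + (bottleneck S₁ S + (ε / 2 : NNReal)) := by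
    rw [add_add_add_comm, ← ENNReal.coe_add, add_halves]
  rw [hsum]
  have h0 := ENNReal.lt_add_right hfin.1.ne hpos
  have h1 := (bottleneck_comm_le S S₁).trans_lt (ENNReal.lt_add_right hfin.2.ne hpos)
  rcases exists_edist_le_bottleneck_add p h0 with ⟨q, hqt, hqd, hq⟩ | hd
  · rcases exists_edist_le_bottleneck_add q h1 with ⟨p', hpt, hpd, hp'⟩ | hd
    · calc r ≤ edist p.pos p'.pos := hfar p' (hqt.trans hpt) (hqd.trans hpd)
        _ ≤ edist p.pos q.pos + edist q.pos p'.pos := edist_triangle _ _ _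
        _ ≤ _ := add_le_add hq.le hp'.le
    · calc r ≤ Metric.infEDist p.pos diagonal := hdiag
        _ ≤ edist p.pos q.pos + Metric.infEDist q.pos diagonal := by
          rw [add_comm]
          exact Metric.infEDist_le_infEDist_add_edist
        _ ≤ _ := add_le_add hq.le hd.le
  · exact (hdiag.trans hd.le).trans le_self_add

/-- Two spaces of heights `[A, B]` and at most `(A + B) / 2` are separated in the persistence
metric: the extended point `(A, B)` of the first one is at distance `(B - A) / 2` from the diagonal
and from the extended points of the second one. -/
theorem le_persistenceDist_add_persistenceDist (𝕜 : Type*) [Field 𝕜] {G₀ G₁ : FilteredSpace}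
    (G : FilteredSpace) {x y : G₀.carrier} (γ : Path x y)
    (hmin : ∀ z, G₀.height x ≤ G₀.height z) (hmax : ∀ z, G₀.height z ≤ G₀.height y)
    (h₁ : ∀ z, G₁.height z ≤ (G₀.height x + G₀.height y) / 2) :
    ENNReal.ofReal ((G₀.height y - G₀.height x) / 2) ≤
      persistenceDist 𝕜 G₀ G + persistenceDist 𝕜 G₁ G := by
  let p : (extendedDiagram 𝕜 G₀.height).Point :=
    ⟨.extended, 0, (G₀.height x, G₀.height y), 0,
      pos_iff_ne_zero.2 (intervalMultiplicity_ord_rel_ne_zero 𝕜 γ hmin hmax)⟩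
  refine le_bottleneck_add_bottleneck _ p (ofReal_half_sub_le_infEDist_diagonal p.pos) ?_
  rintro ⟨type, dim, pos, copy, hcopy⟩ ht hd
  obtain rfl : PointType.extended = type := ht
  have hpos : pos.2 ≤ (G₀.height x + G₀.height y) / 2 := by
    by_contra! hlt
    have hz : extendedDiagram 𝕜 G₁.height .extended dim pos = 0 :=
      intervalMultiplicity_ord_rel_eq_zero 𝕜 dim pos.1 fun z => (h₁ z).trans_lt hlt
    rw [hz] at hcopy
    exact not_lt_bot hcopy
  rw [edist_dist]
  refine ENNReal.ofReal_le_ofReal ?_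
  have h2 : |G₀.height y - pos.2| ≤ dist p.pos pos := le_max_right _ _
  have h3 := le_abs_self (G₀.height y - pos.2)
  change _ ≤ dist p.pos pos
  linarith

/-! ### Filters that are homeomorphisms onto an interval -/

section Morse

open CategoryTheory CategoryTheory.Limits AlgebraicTopology

theorem subsingleton_singularHomology_of_subsingleton.{u} (𝕜 : Type u) [Field 𝕜] (Z : Type)
    [TopologicalSpace Z] [Subsingleton Z] {p : ℕ} (hp : p ≠ 0) :
    Subsingleton (((singularHomologyFunctor (ModuleCat.{u} 𝕜) p).obj
      (ModuleCat.of 𝕜 𝕜)).obj (TopCat.of Z)) := by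
  have : TotallyDisconnectedSpace (TopCat.of Z) := inferInstanceAs (TotallyDisconnectedSpace Z)
  exact ModuleCat.subsingleton_of_isZero
    (isZero_singularHomologyFunctor_of_totallyDisconnectedSpace _ p _ _ hp)

theorem finite_singularHomology_of_subsingleton.{u} (𝕜 : Type u) [Field 𝕜] (Z : Type)
    [TopologicalSpace Z] [Subsingleton Z] (p : ℕ) :
    Module.Finite 𝕜 (((singularHomologyFunctor (ModuleCat.{u} 𝕜) p).obj
      (ModuleCat.of 𝕜 𝕜)).obj (TopCat.of Z)) := by
  rcases eq_or_ne p 0 with rfl | hp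
  · have : TotallyDisconnectedSpace (TopCat.of Z) := inferInstanceAs (TotallyDisconnectedSpace Z)
    let e := singularHomologyFunctorZeroOfTotallyDisconnectedSpace (ModuleCat.{u} 𝕜)
      (ModuleCat.of 𝕜 𝕜) (TopCat.of Z)
    rcases isEmpty_or_nonempty Z with hZ | ⟨⟨z⟩⟩
    · have : IsEmpty (TopCat.of Z) := hZ
      have hzero : IsZero (∐ fun _ : TopCat.of Z => ModuleCat.of 𝕜 𝕜) :=
        (IsZero.iff_id_eq_zero _).2 (Sigma.hom_ext _ _ fun z => isEmptyElim z)
      have := ModuleCat.subsingleton_of_isZero (hzero.of_iso e)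
      infer_instance
    · let _ : Unique (TopCat.of Z) := ⟨⟨z⟩, fun w => Subsingleton.elim (α := Z) w z⟩
      exact Module.Finite.equiv (e ≪≫ coproductUniqueIso _).symm.toLinearEquiv
  · have := subsingleton_singularHomology_of_subsingleton 𝕜 Z hp
    infer_instance

end Morse

/-- A homeomorphism onto a compact interval is a function of Morse type. Its critical values are
the ends of the interval; the fibre is a point between them and empty outside. -/
theorem isMorseType_of_homeomorph_Icc (𝕜 : Type*) [Field 𝕜] {X : Type} [TopologicalSpace X]
    {A B : ℝ} (e : X ≃ₜ Icc A B) : IsMorseType (fun x => (e x : ℝ)) 𝕜 where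
  compact := e.symm.compactSpace
  continuous := continuous_subtype_val.comp e.continuous
  critical := by
    refine ⟨{A, B}, fun u v _ _ _ hcrit => ?_⟩
    by_cases hne : ∃ x, u < (e x : ℝ) ∧ ((e x : ℝ) : EReal) < v
    · obtain ⟨x, hux, hxv⟩ := hne
      have hAu : (A : EReal) ≤ u := by
        by_contra! h
        exact hcrit A (by simp) ⟨h, (EReal.coe_le_coe_iff.2 (e x).2.1).trans_lt hxv⟩
      have hvB : v ≤ (B : EReal) := by
        by_contra! h
        exact hcrit B (by simp) ⟨hux.trans_le (EReal.coe_le_coe_iff.2 (e x).2.2), h⟩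
      have hmem : ∀ t : {t : ℝ // u ≤ t ∧ t ≤ v}, (t : ℝ) ∈ Icc A B := fun t =>
        ⟨EReal.coe_le_coe_iff.1 (hAu.trans t.2.1), EReal.coe_le_coe_iff.1 (t.2.2.trans hvB)⟩
      have hmem' : ∀ t : {t : ℝ // u < t ∧ t < v}, (t : ℝ) ∈ Icc A B := fun t =>
        hmem ⟨t, t.2.1.le, t.2.2.le⟩
      refine ⟨Unit, inferInstance, inferInstance, inferInstance,
        { toFun := fun z => ⟨e.symm ⟨z.2, hmem' z.2⟩, by simpa using z.2.2⟩
          invFun := fun x => ((), ⟨e x, x.2⟩)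
          left_inv := fun z => by simp
          right_inv := fun x => by simp
          continuous_toFun := by fun_prop
          continuous_invFun := by fun_prop },
        { toFun := fun z => ⟨e.symm ⟨z.2, hmem z.2⟩, by simpa using z.2.2⟩
          continuous_toFun := by fun_prop }, ?_, ?_⟩
      · intro z
        simp
      · intro y t ht
        rfl
    · have : IsEmpty {x : X // u < (e x : ℝ) ∧ ((e x : ℝ) : EReal) < v} :=
        ⟨fun x => hne ⟨x, x.2⟩⟩
      refine ⟨Empty, inferInstance, inferInstance, inferInstance, Homeomorph.empty,
        ⟨fun z => z.1.elim, continuous_of_const fun z => z.1.elim⟩,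
        ?_, ?_⟩
      · rintro ⟨⟨⟩, _⟩
      · rintro ⟨⟩
  homology := by
    intro t
    have : Subsingleton {x : X // (e x : ℝ) = t} :=
      ⟨fun x y => Subtype.ext (e.injective (Subtype.ext (x.2.trans y.2.symm)))⟩
    refine ⟨fun p => finite_singularHomology_of_subsingleton 𝕜 _ p, 1, fun p hp => ?_⟩
    exact subsingleton_singularHomology_of_subsingleton 𝕜 _ (Nat.one_le_iff_ne_zero.1 hp)

/-! ### Reach and convexity radius of convex sets -/

section Convex

variable {D : ℕ} {X : Set (EuclideanSpace ℝ (Fin D))}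

theorem existsUnique_edist_eq_infEDist (hX : Convex ℝ X) (hc : IsCompact X) (hne : X.Nonempty)
    (y : EuclideanSpace ℝ (Fin D)) : ∃! x, x ∈ X ∧ edist y x = Metric.infEDist y X := by
  obtain ⟨x, hx, hxy⟩ := hc.exists_infEDist_eq_edist hne y
  refine ⟨x, ⟨hx, hxy.symm⟩, fun x' ⟨hx', hxy'⟩ => ?_⟩
  have heq : ‖y - x'‖ = ‖y - x‖ := by
    rw [← dist_eq_norm, ← dist_eq_norm, dist_edist, dist_edist, hxy', hxy]
  have hmid : ‖y - x‖ ≤ ‖y - midpoint ℝ x x'‖ := by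
    have h := Metric.infEDist_le_edist_of_mem (x := y) (hX.midpoint_mem hx hx')
    rwa [hxy, edist_dist, edist_dist, ENNReal.ofReal_le_ofReal_iff dist_nonneg, dist_eq_norm,
      dist_eq_norm] at h
  have hpar := parallelogram_law_with_norm ℝ (y - x) (y - x')
  have hsum : (y - x) + (y - x') = (2 : ℝ) • (y - midpoint ℝ x x') := by
    rw [midpoint_eq_smul_add, smul_sub, smul_smul]
    norm_num
    rw [two_smul]
    abel
  rw [hsum, norm_smul, sub_sub_sub_cancel_left, heq] at hpar
  norm_num at hpar
  have : ‖x' - x‖ = 0 := by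
    nlinarith [norm_nonneg (x' - x), norm_nonneg (y - x)]
  exact sub_eq_zero.1 (norm_eq_zero.1 this)

theorem reach_eq_top_of_convex (hX : Convex ℝ X) (hc : IsCompact X) (hne : X.Nonempty) :
    reach X = ⊤ :=
  top_le_iff.1 (le_sSup fun y _ => existsUnique_edist_eq_infEDist hX hc hne y)

/-- The straight path between two points of a convex set. -/
noncomputable def segmentPath (hX : Convex ℝ X) (x y : X) : Path x y where
  toFun t := ⟨AffineMap.lineMap (x : EuclideanSpace ℝ (Fin D)) y (t : ℝ),
    hX.segment_subset x.2 y.2 (segment_eq_image_lineMap ℝ (x : EuclideanSpace ℝ (Fin D)) y ▸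
      mem_image_of_mem _ t.2)⟩
  continuous_toFun := Continuous.subtype_mk
    (AffineMap.lineMap_continuous.comp continuous_subtype_val) _
  source' := by simp
  target' := by simp

theorem segmentPath_coe (hX : Convex ℝ X) (x y : X) (t : unitInterval) :
    (segmentPath hX x y t : EuclideanSpace ℝ (Fin D)) =
      AffineMap.lineMap (x : EuclideanSpace ℝ (Fin D)) y (t : ℝ) :=
  rfl

theorem geodesicEDist_eq_edist (hX : Convex ℝ X) (x y : X) : geodesicEDist X x y = edist x y := by
  refine le_antisymm ?_ ?_
  · refine iInf_le_of_le (segmentPath hX x y) ?_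
    have hlip : LipschitzWith (nndist (x : EuclideanSpace ℝ (Fin D)) y)
        (AffineMap.lineMap (k := ℝ) (x : EuclideanSpace ℝ (Fin D)) y) :=
      lipschitzWith_lineMap _ _
    have hcomp := hlip.lipschitzOnWith.comp_eVariationOn_le (s := univ)
      (g := ((↑) : unitInterval → ℝ)) (mapsTo_univ _ _)
    have hmono : eVariationOn ((↑) : unitInterval → ℝ) univ ≤ 1 := by
      have h : MonotoneOn ((↑) : unitInterval → ℝ) univ := fun a _ b _ hab => hab
      have hI : (univ : Set unitInterval) ∩ Icc 0 1 = univ := by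
        ext t
        simp [unitInterval.le_one']
      have := (h.eVariationOn_eq (mem_univ 0) (mem_univ 1)).le
      rw [hI] at this
      simpa using this
    refine hcomp.trans ((mul_le_mul_right hmono _).trans ?_)
    rw [mul_one, Subtype.edist_eq, edist_nndist]
  · refine le_iInf fun γ => ?_
    have := eVariationOn.edist_le (fun t => (γ t : EuclideanSpace ℝ (Fin D)))
      (mem_univ (0 : unitInterval)) (mem_univ 1)
    simpa [Subtype.edist_eq] using this

/-- Every geodesic ball of a convex set is geodesically convex: the minimizing geodesics are
the segments, by strict convexity of the Euclidean norm. -/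
theorem isGeodesicallyConvex_geodesicBall (hX : Convex ℝ X) (x₀ : X) (s : ℝ≥0∞) :
    IsGeodesicallyConvex X {y | geodesicEDist X x₀ y < s} := by
  simp only [IsGeodesicallyConvex, IsMinGeodesic, geodesicEDist_eq_edist hX, mem_ofPred_eq]
  intro x hx y hy
  refine ⟨segmentPath hX x y, fun t t' => ?_, fun t => ?_, fun γ' hγ' => ?_⟩
  · simp only [edist_dist, Subtype.dist_eq, segmentPath_coe, dist_lineMap_lineMap]
    rw [ENNReal.ofReal_mul dist_nonneg]
  · have hball : Convex ℝ (Metric.eball (x₀ : EuclideanSpace ℝ (Fin D)) s) := convex_eball _ _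
    rw [edist_comm]
    refine hball.segment_subset (x := (x : EuclideanSpace ℝ (Fin D))) ?_ ?_ ?_
      (y := (y : EuclideanSpace ℝ (Fin D)))
    · rwa [Metric.mem_eball, edist_comm]
    · rwa [Metric.mem_eball, edist_comm]
    · rw [segment_eq_image_lineMap]
      exact mem_image_of_mem _ t.2
  · ext1
    funext t
    refine Subtype.ext (eq_lineMap_of_dist_eq_mul_of_dist_eq_mul ?_ ?_)
    · have := congrArg ENNReal.toReal (hγ' 0 t)
      rw [ENNReal.toReal_mul] at this
      simpa [← dist_edist, Subtype.dist_eq, abs_of_nonneg t.2.1] using this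
    · have := congrArg ENNReal.toReal (hγ' t 1)
      rw [ENNReal.toReal_mul] at this
      simpa [← dist_edist, Subtype.dist_eq, Real.dist_eq, abs_sub_comm _ (1 : ℝ),
        abs_of_nonneg (sub_nonneg.2 t.2.2)] using this

theorem convexityRadius_eq_top_of_convex (hX : Convex ℝ X) : convexityRadius X = ⊤ :=
  top_le_iff.1 (le_sSup fun x s _ => isGeodesicallyConvex_geodesicBall hX x s)

end Convex

/-! ### Segments on the first coordinate axis -/

section AxisSegment

variable {D : ℕ} [NeZero D] {δ : ℝ}

variable (D) in
/-- The segment `[0, δ] × {0}` on the first coordinate axis of `ℝ^D`. -/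
def axisSegment (δ : ℝ) : Set (EuclideanSpace ℝ (Fin D)) :=
  {y | (∀ i : Fin D, 1 ≤ i.val → y i = 0) ∧ 0 ≤ y 0 ∧ y 0 ≤ δ}

theorem single_zero_mem_axisSegment {s : ℝ} (hs : s ∈ Icc 0 δ) :
    EuclideanSpace.single (0 : Fin D) s ∈ axisSegment D δ := by
  refine ⟨fun i hi => ?_, by simpa using hs.1, by simpa using hs.2⟩
  have : i ≠ 0 := fun h => by simp [h] at hi
  simp [this]

theorem single_zero_apply_of_mem_axisSegment {y : EuclideanSpace ℝ (Fin D)}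
    (hy : y ∈ axisSegment D δ) : EuclideanSpace.single (0 : Fin D) (y 0) = y := by
  ext i
  rcases eq_or_ne i 0 with rfl | hi
  · simp
  · simp [hi, hy.1 i (Nat.one_le_iff_ne_zero.2 fun h => hi (Fin.ext h))]

theorem dist_single_zero (s t : ℝ) :
    dist (EuclideanSpace.single (0 : Fin D) s) (EuclideanSpace.single (0 : Fin D) t) =
      |s - t| := by
  rw [PiLp.dist_single_same, Real.dist_eq]

theorem continuous_single_zero :
    Continuous (EuclideanSpace.single (0 : Fin D) : ℝ → EuclideanSpace ℝ (Fin D)) :=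
  (Isometry.of_dist_eq dist_single_zero).continuous

/-- The first coordinate identifies the segment with the interval `[0, δ]`. -/
noncomputable def axisSegmentHomeomorph (δ : ℝ) : axisSegment D δ ≃ₜ Icc 0 δ where
  toFun y := ⟨(y : EuclideanSpace ℝ (Fin D)) 0, y.2.2⟩
  invFun s := ⟨EuclideanSpace.single (0 : Fin D) (s : ℝ), single_zero_mem_axisSegment s.2⟩
  left_inv y := Subtype.ext (single_zero_apply_of_mem_axisSegment y.2)
  right_inv s := by simp
  continuous_toFun := by fun_prop
  continuous_invFun := by
    refine Continuous.subtype_mk ?_ _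
    exact continuous_single_zero.comp continuous_subtype_val

theorem isCompact_axisSegment : IsCompact (axisSegment D δ) :=
  isCompact_iff_compactSpace.2 (axisSegmentHomeomorph δ).symm.compactSpace

theorem convex_axisSegment : Convex ℝ (axisSegment D δ) := by
  intro x hx y hy a b ha hb hab
  refine ⟨fun i hi => by simp [hx.1 i hi, hy.1 i hi], ?_, ?_⟩
  · have := mul_nonneg ha hx.2.1
    have := mul_nonneg hb hy.2.1
    simp only [PiLp.add_apply, PiLp.smul_apply, smul_eq_mul]
    linarith
  · have h1 := mul_le_mul_of_nonneg_left hx.2.2 ha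
    have h2 := mul_le_mul_of_nonneg_left hy.2.2 hb
    simp only [PiLp.add_apply, PiLp.smul_apply, smul_eq_mul]
    calc a * x 0 + b * y 0 ≤ a * δ + b * δ := add_le_add h1 h2
      _ = δ := by rw [← add_mul, hab, one_mul]

theorem dist_eq_of_mem_axisSegment {x y : EuclideanSpace ℝ (Fin D)} (hx : x ∈ axisSegment D δ)
    (hy : y ∈ axisSegment D δ) : dist x y = |x 0 - y 0| := by
  rw [← dist_single_zero (D := D), single_zero_apply_of_mem_axisSegment hx,
    single_zero_apply_of_mem_axisSegment hy]

theorem dist_le_of_mem_axisSegment {x y : EuclideanSpace ℝ (Fin D)} (hx : x ∈ axisSegment D δ)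
    (hy : y ∈ axisSegment D δ) : dist x y ≤ δ := by
  rw [dist_eq_of_mem_axisSegment hx hy, abs_le]
  constructor <;> linarith [hx.2.1, hx.2.2, hy.2.1, hy.2.2]

theorem diam_axisSegment (hδ : 0 ≤ δ) : Metric.diam (axisSegment D δ) = δ := by
  refine le_antisymm
    (Metric.diam_le_of_forall_dist_le hδ fun x hx y hy => dist_le_of_mem_axisSegment hx hy) ?_
  have h := Metric.dist_le_diam_of_mem (isCompact_axisSegment (D := D) (δ := δ)).isBounded
    (single_zero_mem_axisSegment ⟨hδ, le_rfl⟩) (single_zero_mem_axisSegment ⟨le_rfl, hδ⟩)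
  rwa [dist_single_zero, sub_zero, abs_of_nonneg hδ] at h

/-- Away from `δ • e₀` the segment is the half-line of the standard model; away from `0` the
reflection that exchanges the two ends takes it there. -/
theorem isSmoothSubmanifold_axisSegment (hδ : 0 < δ) :
    IsSmoothSubmanifold (axisSegment D δ) := by
  have hcont : Continuous fun y : EuclideanSpace ℝ (Fin D) => y 0 := by fun_prop
  refine ⟨1, Nat.one_le_iff_ne_zero.2 (NeZero.ne D), fun x hx => ?_⟩
  rcases lt_or_ge (x 0) δ with hxδ | hxδ
  · have hopen : IsOpen {y : EuclideanSpace ℝ (Fin D) | y 0 < δ} :=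
      isOpen_lt hcont continuous_const
    refine ⟨OpenPartialHomeomorph.ofSet _ hopen, hxδ, contDiffOn_id, contDiffOn_id,
      .inr fun y (hy : y 0 < δ) => ?_⟩
    constructor
    · rintro ⟨h1, h2, -⟩
      refine ⟨h1, fun i hi => ?_⟩
      rwa [show i = 0 from Fin.ext hi]
    · rintro ⟨h1, h2⟩
      exact ⟨h1, h2 0 rfl, hy.le⟩
  · have hopen : IsOpen {y : EuclideanSpace ℝ (Fin D) | 0 < y 0} :=
      isOpen_lt continuous_const hcont
    let v : EuclideanSpace ℝ (Fin D) := EuclideanSpace.single 0 δ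
    have hv : ContDiff ℝ (⊤ : ℕ∞) fun y : EuclideanSpace ℝ (Fin D) => v - y :=
      contDiff_const.sub contDiff_id
    refine ⟨(Homeomorph.subLeft v).toOpenPartialHomeomorph.restrOpen _ hopen,
      by simpa using hδ.trans_le hxδ, hv.contDiffOn, ?_, .inr fun y hy => ?_⟩
    · have hw : ContDiff ℝ (⊤ : ℕ∞) fun y : EuclideanSpace ℝ (Fin D) => -y + v :=
        contDiff_id.neg.add contDiff_const
      exact hw.contDiffOn
    · have hy0 : 0 < y 0 := by simpa using hy
      change y ∈ axisSegment D δ ↔ (∀ i : Fin D, 1 ≤ i.val → (v - y) i = 0) ∧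
        ∀ i : Fin D, i.val = 0 → 0 ≤ (v - y) i
      have hvi : ∀ i : Fin D, 1 ≤ i.val → (v - y) i = - y i := fun i hi => by
        have : i ≠ 0 := fun h => by simp [h] at hi
        simp [v, this]
      have hv0 : (v - y) 0 = δ - y 0 := by simp [v]
      constructor
      · rintro ⟨h1, -, h3⟩
        refine ⟨fun i hi => by rw [hvi i hi, h1 i hi, neg_zero], fun i hi => ?_⟩
        rw [show i = 0 from Fin.ext hi, hv0]
        exact sub_nonneg.2 h3
      · rintro ⟨h1, h2⟩
        refine ⟨fun i hi => neg_eq_zero.1 ((hvi i hi).symm.trans (h1 i hi)), hy0.le, ?_⟩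
        have := h2 0 rfl
        rw [hv0] at this
        linarith

end AxisSegment

/-! ### Spiked distributions on a segment -/

section SpikedMeasure

variable {D : ℕ} [NeZero D] {δ q : ℝ}

variable (D) in
/-- The distribution that is `0` with probability `1 - q`, and otherwise uniformly distributed
on the segment `axisSegment D δ`. -/
noncomputable def spikedMeasure (δ q : ℝ) : Measure (EuclideanSpace ℝ (Fin D)) :=
  ENNReal.ofReal (1 - q) • Measure.dirac 0 + ENNReal.ofReal q •
    (volume : Measure unitInterval).map
      fun u : unitInterval => EuclideanSpace.single 0 (δ * (u : ℝ))

theorem continuous_single_zero_mul (δ : ℝ) :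
    Continuous fun u : unitInterval => EuclideanSpace.single (0 : Fin D) (δ * (u : ℝ)) :=
  continuous_single_zero.comp (by fun_prop)

theorem isProbabilityMeasure_spikedMeasure (hq : q ∈ Icc 0 1) :
    IsProbabilityMeasure (spikedMeasure D δ q) := by
  constructor
  have := Measure.isProbabilityMeasure_map (μ := (volume : Measure unitInterval))
    (continuous_single_zero_mul (D := D) δ).aemeasurable
  rw [spikedMeasure, Measure.add_apply, Measure.smul_apply, Measure.smul_apply, measure_univ,
    measure_univ, smul_eq_mul, smul_eq_mul, mul_one, mul_one,
    ← ENNReal.ofReal_add (sub_nonneg.2 hq.2) hq.1, sub_add_cancel, ENNReal.ofReal_one]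

theorem le_spikedMeasure_singleton_zero :
    ENNReal.ofReal (1 - q) ≤ spikedMeasure D δ q {0} := by
  rw [spikedMeasure, Measure.add_apply, Measure.smul_apply,
    Measure.dirac_apply_of_mem (mem_singleton _),
    smul_eq_mul, mul_one]
  exact le_self_add

theorem spikedMeasure_axisSegment_compl (hδ : 0 ≤ δ) :
    spikedMeasure D δ q (axisSegment D δ)ᶜ = 0 := by
  have hmem : ∀ u : unitInterval, EuclideanSpace.single (0 : Fin D) (δ * (u : ℝ)) ∈
      axisSegment D δ := fun u => single_zero_mem_axisSegment
    ⟨mul_nonneg hδ u.2.1, mul_le_of_le_one_right hδ u.2.2⟩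
  have h0 : (0 : EuclideanSpace ℝ (Fin D)) ∈ axisSegment D δ := by
    have h : EuclideanSpace.single (0 : Fin D) (0 : ℝ) = 0 := by simp
    rw [← h]
    exact single_zero_mem_axisSegment ⟨le_rfl, hδ⟩
  have hmeas : MeasurableSet (axisSegment D δ)ᶜ := isCompact_axisSegment.measurableSet.compl
  rw [spikedMeasure, Measure.add_apply, Measure.smul_apply, Measure.smul_apply,
    Measure.dirac_apply' _ hmeas,
    Measure.map_apply (continuous_single_zero_mul δ).measurable hmeas]
  have : (fun u : unitInterval => EuclideanSpace.single (0 : Fin D) (δ * (u : ℝ))) ⁻¹'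
      (axisSegment D δ)ᶜ = ∅ := eq_empty_of_forall_notMem fun u hu => hu (hmem u)
  rw [this]
  simp [h0]

theorem ofReal_le_volume_unitInterval_ball (u : unitInterval) {r : ℝ} (hr : r ∈ Icc (0 : ℝ) 1) :
    ENNReal.ofReal r ≤ volume {v : unitInterval | |(v : ℝ) - u| ≤ r} := by
  -- an interval of length `r` that contains `u`, moved left where `[u, u + r]` leaves `[0, 1]`
  let lo : ℝ := min u (1 - r)
  have hlo : 0 ≤ lo := le_min u.2.1 (sub_nonneg.2 hr.2)
  have hlo' : lo + r ≤ 1 := by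
    have : lo ≤ 1 - r := min_le_right _ _
    linarith
  have hsub : Icc (⟨lo, hlo, by linarith [hr.1]⟩ : unitInterval)
      ⟨lo + r, by linarith [hr.1], hlo'⟩ ⊆ {v : unitInterval | |(v : ℝ) - u| ≤ r} := by
    rintro v ⟨h1, h2⟩
    have h1' : lo ≤ v := h1
    have h2' : (v : ℝ) ≤ lo + r := h2
    have hle : lo ≤ u := min_le_left _ _
    change |(v : ℝ) - u| ≤ r
    refine abs_le.2 ⟨?_, by linarith⟩
    rcases min_choice (u : ℝ) (1 - r) with h | h
    · have : lo = u := h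
      linarith [hr.1]
    · have : lo = 1 - r := h
      linarith [u.2.2]
  refine le_trans (le_of_eq ?_) (measure_mono hsub)
  rw [unitInterval.volume_Icc]
  simp

theorem le_spikedMeasure_closedBall (hδ : 0 < δ) {x : EuclideanSpace ℝ (Fin D)}
    (hx : x ∈ axisSegment D δ) {t : ℝ} (ht : t ∈ Icc 0 δ) (hq : 0 ≤ q) :
    ENNReal.ofReal (q * (t / δ)) ≤ spikedMeasure D δ q (Metric.closedBall x t) := by
  have hu : x 0 / δ ∈ Icc (0 : ℝ) 1 := ⟨div_nonneg hx.2.1 hδ.le, (div_le_one hδ).2 hx.2.2⟩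
  have hr : t / δ ∈ Icc (0 : ℝ) 1 := ⟨div_nonneg ht.1 hδ.le, (div_le_one hδ).2 ht.2⟩
  rw [spikedMeasure, Measure.add_apply, Measure.smul_apply, Measure.smul_apply, smul_eq_mul,
    smul_eq_mul, ENNReal.ofReal_mul hq,
    Measure.map_apply (continuous_single_zero_mul δ).measurable measurableSet_closedBall]
  refine le_add_of_nonneg_of_le bot_le (mul_le_mul_right ?_ _)
  refine (ofReal_le_volume_unitInterval_ball ⟨_, hu⟩ hr).trans (measure_mono fun v hv => ?_)
  rw [mem_preimage, Metric.mem_closedBall, ← single_zero_apply_of_mem_axisSegment hx,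
    dist_single_zero]
  have hv' : |(v : ℝ) - x 0 / δ| ≤ t / δ := hv
  have : δ * (v : ℝ) - x 0 = δ * (v - x 0 / δ) := by field_simp
  rw [this, abs_mul, abs_of_pos hδ, mul_comm]
  exact (le_div_iff₀ hδ).1 hv'

theorem support_spikedMeasure (hδ : 0 < δ) (hq : 0 < q) :
    (spikedMeasure D δ q).support = axisSegment D δ := by
  refine Subset.antisymm (Measure.support_subset_of_isClosed isCompact_axisSegment.isClosed
    (spikedMeasure_axisSegment_compl hδ.le)) fun x hx => ?_
  rw [Measure.mem_support_iff_forall]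
  intro U hU
  obtain ⟨ε, hε, hεU⟩ := Metric.nhds_basis_closedBall.mem_iff.1 hU
  have ht : 0 < min ε δ := lt_min hε hδ
  have h := le_spikedMeasure_closedBall hδ hx ⟨ht.le, min_le_right ε δ⟩ hq.le
  refine lt_of_lt_of_le (ENNReal.ofReal_pos.2 (mul_pos hq (div_pos ht hδ))) (h.trans ?_)
  exact measure_mono ((Metric.closedBall_subset_closedBall (min_le_left _ _)).trans hεU)

/-- A short enough segment carries `(a, b)`-standard distributions that put only the mass `q`
away from the origin: `a t ^ b ≤ q (t / δ)` for `t ≤ δ`, and larger balls have mass one. -/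
theorem inModel_of_eq_spikedMeasure {a b κ ρ L : ℝ} (hb : 1 ≤ b) (hδ : 0 < δ)
    (hδL : δ < L) (hq : 0 < q) (haq : a * δ ^ b ≤ q)
    {P : ProbabilityMeasure (EuclideanSpace ℝ (Fin D))}
    (hP : (P : Measure (EuclideanSpace ℝ (Fin D))) = spikedMeasure D δ q) :
    InModel D a b κ ρ L P := by
  have hsupp : supp P = axisSegment D δ := by
    rw [supp, hP, support_spikedMeasure hδ hq]
  have hne : (axisSegment D δ).Nonempty := ⟨_, single_zero_mem_axisSegment ⟨le_rfl, hδ.le⟩⟩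
  constructor
  · intro x hx t ht
    rw [hsupp] at hx
    rcases le_total t δ with htδ | htδ
    · rw [hP]
      refine le_trans (ENNReal.ofReal_le_ofReal ((min_le_right _ _).trans ?_))
        (le_spikedMeasure_closedBall hδ hx ⟨ht.le, htδ⟩ hq.le)
      have htd : t / δ ≤ 1 := (div_le_one hδ).2 htδ
      have hpow : (t / δ) ^ b ≤ t / δ := by
        simpa using Real.rpow_le_rpow_of_exponent_ge (div_pos ht hδ) htd hb
      calc a * t ^ b = a * δ ^ b * (t / δ) ^ b := by
            rw [mul_assoc, ← Real.mul_rpow hδ.le (div_pos ht hδ).le, mul_div_cancel₀ _ hδ.ne']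
        _ ≤ q * (t / δ) := mul_le_mul haq hpow (by positivity) hq.le
    · have hfull : (P : Measure (EuclideanSpace ℝ (Fin D))) (Metric.closedBall x t) = 1 := by
        rw [prob_compl_eq_zero_iff Metric.isClosed_closedBall.measurableSet |>.symm]
        refine measure_mono_null (compl_subset_compl.2 fun y hy => ?_)
          (hP ▸ spikedMeasure_axisSegment_compl (q := q) hδ.le)
        exact (dist_le_of_mem_axisSegment hy hx).trans htδ
      rw [hfull]
      exact ENNReal.ofReal_le_one.2 (min_le_left _ _)
  · rw [hsupp]
    exact isCompact_axisSegment
  · rw [hsupp]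
    exact isSmoothSubmanifold_axisSegment hδ
  · rw [hsupp, reach_eq_top_of_convex convex_axisSegment isCompact_axisSegment hne]
    exact ENNReal.ofReal_lt_top
  · rw [hsupp, convexityRadius_eq_top_of_convex convex_axisSegment]
    exact ENNReal.ofReal_lt_top
  · rwa [hsupp, diam_axisSegment hδ.le]
  · rwa [hsupp, diam_axisSegment hδ.le]

end SpikedMeasure

/-! ### Linear filters on a segment -/

section Filter

variable {D : ℕ} [NeZero D] {δ m : ℝ}

/-- Subadditivity: `ω Δ ≤ ⌈Δ / r⌉ ω r`, and `⌈Δ / r⌉ ≤ 2 Δ / r`. -/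
theorem IsModulusOfContinuity.div_mul_le {ω : ℝ → ℝ} (hω : IsModulusOfContinuity ω) {r Δ : ℝ}
    (hr : 0 ≤ r) (hrΔ : r ≤ Δ) : ω Δ / (2 * Δ) * r ≤ ω r := by
  rcases hr.eq_or_lt with rfl | hr
  · simp [hω.zero]
  have hΔ : 0 < Δ := hr.trans_le hrΔ
  have hmul : ∀ k : ℕ, ω (k * r) ≤ k * ω r := by
    intro k
    induction k with
    | zero => simp [hω.zero]
    | succ k ih =>
      have := hω.subadditive (k * r) r (by positivity) hr.le
      push_cast
      rw [add_mul, one_mul, add_mul, one_mul]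
      linarith
  have hceil : Δ ≤ ⌈Δ / r⌉₊ * r := (div_le_iff₀ hr).1 (Nat.le_ceil _)
  have hω1 : ω Δ ≤ ⌈Δ / r⌉₊ * ω r :=
    (hω.mono hΔ.le (hΔ.le.trans hceil) hceil).trans (hmul _)
  have hle : (⌈Δ / r⌉₊ : ℝ) ≤ 2 * Δ / r := by
    have h1 := (Nat.ceil_lt_add_one (div_nonneg hΔ.le hr.le)).le
    have h2 : 1 ≤ Δ / r := (one_le_div hr).2 hrΔ
    calc (⌈Δ / r⌉₊ : ℝ) ≤ Δ / r + Δ / r := by linarith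
      _ = 2 * Δ / r := by ring
  calc ω Δ / (2 * Δ) * r ≤ (2 * Δ / r * ω r) / (2 * Δ) * r := by
        have := hω1.trans (mul_le_mul_of_nonneg_right hle (hω.nonneg r hr.le))
        gcongr
    _ = ω r := by field_simp

theorem inFilterClass_mul_coord_zero (𝕜 : Type*) [Field 𝕜]
    {P : ProbabilityMeasure (EuclideanSpace ℝ (Fin D))} (hP : supp P = axisSegment D δ)
    {ω : ℝ → ℝ} (hω : MonotoneOn ω (Ici 0)) (hm : 0 < m)
    (hmω : ∀ r, 0 ≤ r → r ≤ δ → m * r ≤ ω r) :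
    InFilterClass 𝕜 P ω fun y => m * y 0 where
  morse := by
    let scale : Icc 0 δ ≃ₜ Icc (m * 0) (m * δ) :=
      (Homeomorph.mulLeft₀ m hm.ne').subtype fun t => by
        simp [mem_Icc, mul_le_mul_iff_right₀ hm, mul_nonneg_iff_of_pos_left hm]
    exact isMorseType_of_homeomorph_Icc 𝕜
      (((Homeomorph.setCongr hP).trans (axisSegmentHomeomorph δ)).trans scale)
  modulus_le := by
    intro s hs x x' hxx'
    have hx : (x : EuclideanSpace ℝ (Fin D)) ∈ axisSegment D δ := hP ▸ x.2
    have hx' : (x' : EuclideanSpace ℝ (Fin D)) ∈ axisSegment D δ := hP ▸ x'.2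
    have h : |filterOn P (fun y => m * y 0) x - filterOn P (fun y => m * y 0) x'| =
        m * dist x x' := by
      rw [Subtype.dist_eq, dist_eq_of_mem_axisSegment hx hx', filterOn, filterOn, ← mul_sub,
        abs_mul, abs_of_pos hm]
    rw [h]
    exact (hmω _ dist_nonneg (dist_le_of_mem_axisSegment hx hx')).trans
      (hω dist_nonneg hs.le hxx')

/-- The Reeb graphs of a linear filter on a segment and on its first half are apart in the
persistence metric. -/
theorem le_persistenceDist_add_persistenceDist_axisSegment (𝕜 : Type*) [Field 𝕜]
    {P₀ P₁ : ProbabilityMeasure (EuclideanSpace ℝ (Fin D))} (hδ : 0 ≤ δ)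
    (h₀ : supp P₀ = axisSegment D δ) (h₁ : supp P₁ = axisSegment D (δ / 2)) (hm : 0 ≤ m)
    (G : FilteredSpace) :
    ENNReal.ofReal (m * δ / 2) ≤
      persistenceDist 𝕜 (reebGraph (filterOn P₀ fun y => m * y 0)) G +
      persistenceDist 𝕜 (reebGraph (filterOn P₁ fun y => m * y 0)) G := by
  have hmem : ∀ s ∈ Icc 0 δ, EuclideanSpace.single (0 : Fin D) s ∈ supp P₀ := fun s hs =>
    h₀ ▸ single_zero_mem_axisSegment hs
  have hconv : Convex ℝ (supp P₀) := h₀ ▸ convex_axisSegment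
  let x : supp P₀ := ⟨_, hmem 0 ⟨le_rfl, hδ⟩⟩
  let y : supp P₀ := ⟨_, hmem δ ⟨hδ, le_rfl⟩⟩
  let f₀ : supp P₀ → ℝ := filterOn P₀ fun y => m * y 0
  let f₁ : supp P₁ → ℝ := filterOn P₁ fun y => m * y 0
  let γ : Path (X := (reebGraph f₀).carrier) (Quotient.mk (reebSetoid f₀) x)
      (Quotient.mk (reebSetoid f₀) y) :=
    (segmentPath hconv x y).map continuous_quotient_mk'
  have hx : (reebGraph f₀).height (Quotient.mk (reebSetoid f₀) x) = 0 := by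
    change m * EuclideanSpace.single (0 : Fin D) (0 : ℝ) 0 = 0
    simp
  have hy : (reebGraph f₀).height (Quotient.mk (reebSetoid f₀) y) = m * δ := by
    change m * EuclideanSpace.single (0 : Fin D) δ 0 = m * δ
    simp
  have hrange : ∀ z : (reebGraph f₀).carrier,
      0 ≤ (reebGraph f₀).height z ∧ (reebGraph f₀).height z ≤ m * δ := by
    refine Quotient.ind fun z => ?_
    have hz : (z : EuclideanSpace ℝ (Fin D)) ∈ axisSegment D δ := h₀ ▸ z.2
    exact ⟨mul_nonneg hm hz.2.1, mul_le_mul_of_nonneg_left hz.2.2 hm⟩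
  have hrange' : ∀ z : (reebGraph f₁).carrier, (reebGraph f₁).height z ≤ (0 + m * δ) / 2 := by
    refine Quotient.ind fun z => ?_
    have hz : (z : EuclideanSpace ℝ (Fin D)) ∈ axisSegment D (δ / 2) := h₁ ▸ z.2
    have := mul_le_mul_of_nonneg_left hz.2.2 hm
    change m * (z : EuclideanSpace ℝ (Fin D)) 0 ≤ _
    linarith
  have := le_persistenceDist_add_persistenceDist 𝕜 (G₀ := reebGraph f₀) (G₁ := reebGraph f₁) G γ
    (by simpa only [hx] using fun z => (hrange z).1)
    (by simpa only [hy] using fun z => (hrange z).2) (by simpa only [hx, hy] using hrange')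
  rwa [hx, hy, sub_zero] at this

end Filter

/-! ### The two-point lower bound -/

/-- If `P` has an atom of mass at least `1 - q` at the origin, all `n` observations are `0` with
probability at least `1 - n q`. This event is an atom of the product measure, so the bound holds
for the lower integral of any loss, measurable or not. -/
theorem le_risk_of_le_singleton_zero (𝕜 : Type*) [Field 𝕜] {D n : ℕ} {ω : ℝ → ℝ}
    (R : Estimator D n) {P : ProbabilityMeasure (EuclideanSpace ℝ (Fin D))} {q : ℝ}
    (hq : q ∈ Icc 0 1)
    (hP : ENNReal.ofReal (1 - q) ≤ (P : Measure (EuclideanSpace ℝ (Fin D))) {0})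
    {g : EuclideanSpace ℝ (Fin D) → ℝ} (hg : InFilterClass 𝕜 P ω g) :
    persistenceDist 𝕜 (reebGraph (filterOn P g)) (R 0 g) * ENNReal.ofReal (1 - n * q) ≤
      risk 𝕜 ω R P := by
  have hpow : ENNReal.ofReal (1 - n * q) ≤
      Measure.pi (fun _ : Fin n => (P : Measure (EuclideanSpace ℝ (Fin D)))) {0} := by
    rw [Measure.pi_singleton]
    calc ENNReal.ofReal (1 - n * q) ≤ ENNReal.ofReal ((1 - q) ^ n) := by
          refine ENNReal.ofReal_le_ofReal ?_
          have := one_add_mul_le_pow (a := -q) (by linarith [hq.2]) n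
          rw [← sub_eq_add_neg] at this
          linarith
      _ = ∏ _i : Fin n, ENNReal.ofReal (1 - q) := by
          rw [ENNReal.ofReal_pow (sub_nonneg.2 hq.2), Finset.prod_const, Finset.card_univ,
            Fintype.card_fin]
      _ ≤ _ := Finset.prod_le_prod' fun i _ => hP
  rw [risk]
  refine le_trans ?_ (setLIntegral_le_lintegral {0} _)
  rw [lintegral_singleton]
  refine mul_le_mul' (le_iSup₂_of_le g hg le_rfl) hpow

end ReebMinimax

theorem mainTheorem5 (D : ℕ) (hD : 1 ≤ D) (a b κ ρ L : ℝ) (ha : 0 < a) (hb : (D : ℝ) ≤ b)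
    (hκ : 0 < κ) (hρ : 0 < ρ) (hL : 0 < L) :
    ∃ C : ℝ, 0 < C ∧
      ∀ (𝕜 : Type*) [Field 𝕜] (ω : ℝ → ℝ), ReebMinimax.IsModulusOfContinuity ω →
      ∀ (n : ℕ), 1 ≤ n → ∀ R : ReebMinimax.Estimator D n,
        ENNReal.ofReal (C * ω ((1 / (a * n)) ^ (1 / b))) ≤
          ⨆ P : MeasureTheory.ProbabilityMeasure (EuclideanSpace ℝ (Fin D)),
            ⨆ _ : ReebMinimax.InModel D a b κ ρ L P, ReebMinimax.risk 𝕜 ω R P := by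
  open ReebMinimax in
  have : NeZero D := ⟨Nat.one_le_iff_ne_zero.1 hD⟩
  have hb1 : 1 ≤ b := le_trans (by exact_mod_cast hD) hb
  have hb0 : 0 < b := zero_lt_one.trans_le hb1
  have hK : 0 < (1 / a) ^ (1 / b) := by positivity
  -- `c ≤ 1 / 2` gives the standard condition, the other bound keeps the diameter below `L`
  let c : ℝ := min (1 / 2) (L / (2 * (1 / a) ^ (1 / b)))
  have hc : 0 < c := lt_min (by norm_num) (by positivity)
  have hc2 : c ≤ 1 / 2 := min_le_left _ _
  -- `ω δ ≥ c / 2 * ω Δ` below, and the risk is at least `ω δ / 16`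
  refine ⟨c / 32, by positivity, fun 𝕜 _ ω hω n hn R => ?_⟩
  have hn0 : (0 : ℝ) < n := by exact_mod_cast hn
  have hn1 : (1 : ℝ) ≤ n := by exact_mod_cast hn
  set Δ : ℝ := (1 / (a * n)) ^ (1 / b) with hΔdef
  have hΔ : 0 < Δ := by positivity
  have hΔb : Δ ^ b = 1 / (a * n) := by
    rw [hΔdef, ← Real.rpow_mul (by positivity), one_div_mul_cancel hb0.ne', Real.rpow_one]
  let δ : ℝ := c * Δ
  have hδ : 0 < δ := by positivity
  have hδΔ : δ ≤ Δ := mul_le_of_le_one_left hΔ.le (by linarith)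
  have hδL : δ < L := by
    have h1 : Δ ≤ (1 / a) ^ (1 / b) :=
      Real.rpow_le_rpow (by positivity)
        (one_div_le_one_div_of_le ha (le_mul_of_one_le_right ha.le hn1)) (by positivity)
    calc δ ≤ L / (2 * (1 / a) ^ (1 / b)) * (1 / a) ^ (1 / b) :=
          mul_le_mul (min_le_right _ _) h1 hΔ.le (by positivity)
      _ = L / 2 := by field_simp
      _ < L := half_lt_self hL
  let q : ℝ := 1 / (2 * n)
  have hq : 0 < q := by positivity
  have hq1 : q ≤ 1 := (div_le_one (by positivity)).2 (by linarith)
  have haq : a * δ ^ b ≤ q := by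
    have hcb : c ^ b ≤ 1 / 2 := by
      refine le_trans ?_ hc2
      simpa using Real.rpow_le_rpow_of_exponent_ge hc (by linarith) hb1
    calc a * δ ^ b = c ^ b * (1 / n) := by
          rw [Real.mul_rpow hc.le hΔ.le, hΔb]
          field_simp
      _ ≤ 1 / 2 * (1 / n) := by gcongr
      _ = q := by ring
  have haq' : a * (δ / 2) ^ b ≤ q := by
    refine le_trans ?_ haq
    gcongr
    linarith
  have hωδ : c / 2 * ω Δ ≤ ω δ := by
    refine le_trans (le_of_eq ?_) (hω.div_mul_le hδ.le hδΔ)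
    change _ = ω Δ / (2 * Δ) * (c * Δ)
    field_simp
  rcases (hω.nonneg δ hδ.le).eq_or_lt with hzero | hpos
  · have : c / 32 * ω Δ ≤ 0 := by linarith
    rw [ENNReal.ofReal_of_nonpos this]
    exact bot_le
  let P₀ : ProbabilityMeasure (EuclideanSpace ℝ (Fin D)) :=
    ⟨spikedMeasure D δ q, isProbabilityMeasure_spikedMeasure ⟨hq.le, hq1⟩⟩
  let P₁ : ProbabilityMeasure (EuclideanSpace ℝ (Fin D)) :=
    ⟨spikedMeasure D (δ / 2) q, isProbabilityMeasure_spikedMeasure ⟨hq.le, hq1⟩⟩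
  have hsupp₀ : supp P₀ = axisSegment D δ := support_spikedMeasure hδ hq
  have hsupp₁ : supp P₁ = axisSegment D (δ / 2) := support_spikedMeasure (half_pos hδ) hq
  have hP₀ : InModel D a b κ ρ L P₀ := inModel_of_eq_spikedMeasure hb1 hδ hδL hq haq rfl
  have hP₁ : InModel D a b κ ρ L P₁ :=
    inModel_of_eq_spikedMeasure hb1 (half_pos hδ) (by linarith) hq haq' rfl
  let m : ℝ := ω δ / (2 * δ)
  have hm : 0 < m := by positivity
  have hmω : ∀ r, 0 ≤ r → r ≤ δ → m * r ≤ ω r := fun r hr hrδ => hω.div_mul_le hr hrδ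
  have hg₀ : InFilterClass 𝕜 P₀ ω fun y => m * y 0 :=
    inFilterClass_mul_coord_zero 𝕜 hsupp₀ hω.mono hm hmω
  have hg₁ : InFilterClass 𝕜 P₁ ω fun y => m * y 0 :=
    inFilterClass_mul_coord_zero 𝕜 hsupp₁ hω.mono hm fun r hr hrδ => hmω r hr (by linarith)
  have hr₀ := le_risk_of_le_singleton_zero 𝕜 R ⟨hq.le, hq1⟩ le_spikedMeasure_singleton_zero hg₀
  have hr₁ := le_risk_of_le_singleton_zero 𝕜 R ⟨hq.le, hq1⟩ le_spikedMeasure_singleton_zero hg₁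
  have hdist := le_persistenceDist_add_persistenceDist_axisSegment 𝕜 hδ.le hsupp₀ hsupp₁ hm.le
    (R 0 fun y => m * y 0)
  have hnq : 1 - n * q = 1 / 2 := by
    change 1 - n * (1 / (2 * n)) = (1 : ℝ) / 2
    field_simp
    norm_num
  set M : ℝ≥0∞ := ⨆ P : ProbabilityMeasure (EuclideanSpace ℝ (Fin D)),
    ⨆ _ : InModel D a b κ ρ L P, risk 𝕜 ω R P
  have hM₀ := hr₀.trans (le_iSup₂ (f := fun P (_ : InModel D a b κ ρ L P) => risk 𝕜 ω R P) P₀ hP₀)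
  have hM₁ := hr₁.trans (le_iSup₂ (f := fun P (_ : InModel D a b κ ρ L P) => risk 𝕜 ω R P) P₁ hP₁)
  rw [hnq] at hM₀ hM₁
  have hsum : ENNReal.ofReal (m * δ / 2) * ENNReal.ofReal (1 / 2) ≤ M * 2 := by
    rw [mul_two]
    refine (mul_le_mul_left hdist _).trans ?_
    rw [add_mul]
    exact add_le_add hM₀ hM₁
  have hmδ : m * δ = ω δ / 2 := by
    change ω δ / (2 * δ) * δ = _
    field_simp
  rw [← ENNReal.ofReal_mul (by positivity), hmδ] at hsum
  calc ENNReal.ofReal (c / 32 * ω Δ) ≤ ENNReal.ofReal (ω δ / 2 / 2 * (1 / 2) / 2) :=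
        ENNReal.ofReal_le_ofReal (by linarith)
    _ = ENNReal.ofReal (ω δ / 2 / 2 * (1 / 2)) / 2 := by
        rw [ENNReal.ofReal_div_of_pos two_pos, ENNReal.ofReal_ofNat]
    _ ≤ M := ENNReal.div_le_of_le_mul hsum
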